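/- Let $P$ be a finite set of points and $B$ a finite set of regions in $\mathbb{R}^d$. Their incidence graph $G(P,B)$ is the bipartite graph with vertex classes $P$ and $B$ in which $p \in P$ and $R \in B$ are adjacent if and only if $p \in R$; the number of incidences $I(P,B)$ is the number of edges of $G(P,B)$. An orthant in $\mathbb{R}^3$ is a product $J_1 \times J_2 \times J_3$ in which each $J_i$ is a closed ray, $(-\infty,q_i]$ or $[q_i,\infty)$ with $q_i \in \mathbb{R}$ (all eight types are allowed, also together in one set $B$). A 3-sided rectangle in $\mathbb{R}^2$ is an axis-parallel set of one of the four forms $[a,b]\times(-\infty,h]$, $[a,b]\times[h,\infty)$, $(-\infty,h]\times[a,b]$, $[h,\infty)\times[a,b]$, with real $a \le b$ and $h$. Then there is an absolute constant $C > 0$ such that the following two statements hold for all integers $k \ge 1$ and $n, m \ge 0$. (i) If $P$ is a set of $n$ points and $B$ is a set of $m$ orthants, both in $\mathbb{R}^3$, and $G(P,B)$ does not contain the complete bipartite graph $K_{k,k}$ as a subgraph, then $I(P,B) \le C\,k\,(n+m)$. (ii) If $P$ is a set of $n$ points and $B$ is a set of $m$ 3-sided rectangles, both in $\mathbb{R}^2$,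 and $G(P,B)$ does not contain $K_{k,k}$ as a subgraph, then $I(P,B) \le C\,k\,(n+m)$. -/

import Mathlib

/-- The incidence graph between a finite set `P` of points and a finite set `B` of regions: the
bipartite graph on the disjoint union of `P` and `B` in which a point is joined to a region exactly
when it lies in it. -/
def incidenceGraph {X : Type*} (P : Finset X) (B : Finset (Set X)) : SimpleGraph (P ⊕ B) where
  Adj u v :=
    match u, v with
    | .inl p, .inr R => (p : X) ∈ (R : Set X)
    | .inr R, .inl p => (p : X) ∈ (R : Set X)
    | .inl _, .inl _ => False
    | .inr _, .inr _ => False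
  symm := ⟨by
    rintro (p | R) (q | S) h
    · exact h
    · exact h
    · exact h
    · exact h⟩
  loopless := ⟨by
    rintro (p | R) h
    · exact h
    · exact h⟩

/-- The number of incidences between `P` and `B`: the number of edges of the incidence graph. -/
noncomputable def numIncidences {X : Type*} (P : Finset X) (B : Finset (Set X)) : ℕ :=
  (incidenceGraph P B).edgeSet.ncard

/-- The incidence graph does not contain `K_{k,k}` as a (not necessarily induced) subgraph. -/
def IncidenceKFree {X : Type*} (k : ℕ) (P : Finset X) (B : Finset (Set X)) : Prop :=
  (completeBipartiteGraph (Fin k) (Fin k)).Free (incidenceGraph P B)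

/-- An orthant of `ℝ³`, of any of the eight types: a product of three closed rays, each of
the form `(-∞, q_i]` or `[q_i, ∞)`. -/
def IsOrthant (R : Set (Fin 3 → ℝ)) : Prop :=
  ∃ (q : Fin 3 → ℝ) (s : Fin 3 → Bool),
    R = {p | ∀ i, if s i then p i ≤ q i else q i ≤ p i}

/-- An axis-parallel 3-sided rectangle of `ℝ²`, of any of the four types: the product of a closed
interval `[a, b]` in one of the coordinates and a closed ray `(-∞, h]` or `[h, ∞)` in the other. -/
def IsThreeSidedRectangle (R : Set (Fin 2 → ℝ)) : Prop :=
  ∃ (i j : Fin 2) (a b h : ℝ), i ≠ j ∧ a ≤ b ∧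
    (R = {p | p i ∈ Set.Icc a b ∧ p j ≤ h} ∨ R = {p | p i ∈ Set.Icc a b ∧ h ≤ p j})

/-!
In suitable coordinates a region is an upper orthant `{p | y ≤ x p}` of a three-dimensional order.
Fix a region `R` and call `p ∈ P ∩ R` rich in `R` if, for some coordinate `i`, at least `k` points
of `P ∩ R` dominate `p` in the two coordinates other than `i`.

Of any two points one dominates the other in two of the three coordinates. Hence, by counting pairs,
each region has at most `6k` incidences with poor points. On the other hand, list the points of `P`
dominating `p` off `i` by decreasing `i`-th coordinate: every orthant in which `p` is rich through
`i` contains the first `k` of them, so by the exclusion of `K_{k,k}` there are fewer than `k` such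
orthants, and each point is rich in at most `3k` regions.
-/

section Domination

open Finset

variable {X T ι : Type*}

/-- An upper orthant of the coordinates `x`: the points whose coordinates are all bounded below by
those of some apex `y`. -/
def IsUpperOrthant [Preorder T] (x : X → ι → T) (R : Set X) : Prop :=
  ∃ y, R = x ⁻¹' Set.Ici y

section LE

variable [LE T] [DecidableLE T] [Fintype ι] [DecidableEq ι]

/-- The members of `S` that dominate `p`, with respect to the coordinates `x`, in every coordinate
other than `i`; the `i`-th coordinate is not constrained, and `p` counts as dominating itself. -/
def dominatorsOff (x : X → ι → T) (S : Finset X) (p : X) (i : ι) : Finset X :=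
  {q ∈ S | ∀ j ≠ i, x p j ≤ x q j}

/-- A point `p` is `k`-rich in `S` if at least `k` members of `S` dominate it in all but one
prescribed coordinate. An incidence of `p` with a region will be charged to `p` or to the region
according to whether `p` is rich in the set of points of the region. -/
def IsRich (k : ℕ) (x : X → ι → T) (S : Finset X) (p : X) : Prop :=
  ∃ i, k ≤ #(dominatorsOff x S p i)

theorem mem_dominatorsOff {x : X → ι → T} {S : Finset X} {p q : X} {i : ι} :
    q ∈ dominatorsOff x S p i ↔ q ∈ S ∧ ∀ j ≠ i, x p j ≤ x q j :=
  mem_filter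

theorem dominatorsOff_mono (x : X → ι → T) {S S' : Finset X} (h : S ⊆ S') (p : X)
    (i : ι) : dominatorsOff x S p i ⊆ dominatorsOff x S' p i :=
  filter_subset_filter _ h

end LE

variable [LinearOrder T]

theorem exists_forall_ne_le_or_forall_ne_le (v w : Fin 3 → T) :
    ∃ i, (∀ j ≠ i, v j ≤ w j) ∨ ∀ j ≠ i, w j ≤ v j := by
  rcases le_total (v 0) (w 0) with h0 | h0 <;> rcases le_total (v 1) (w 1) with h1 | h1 <;>
    rcases le_total (v 2) (w 2) with h2 | h2 <;>
    simp [Fin.exists_fin_succ, Fin.forall_fin_succ, h0, h1, h2]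

theorem card_le_of_card_dominatorsOff_le (x : X → Fin 3 → T) {S : Finset X} {m : ℕ}
    (h : ∀ p ∈ S, ∀ i, #(dominatorsOff x S p i) ≤ m) : #S ≤ 6 * m := by
  classical
  let r (p q : X) : Prop := ∃ i, ∀ j ≠ i, x p j ≤ x q j
  have above : ∀ p ∈ S, #(S.bipartiteAbove r p) ≤ 3 * m := fun p hp =>
    calc #(S.bipartiteAbove r p) ≤ #(univ.biUnion (dominatorsOff x S p)) :=
          card_le_card fun q hq => by
            simpa [r, bipartiteAbove, mem_dominatorsOff] using hq
      _ ≤ 3 * m := card_biUnion_le_card_mul _ _ _ fun i _ => h p hp i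
  have total : ∀ p ∈ S, #S ≤ #(S.bipartiteAbove r p) + #(S.bipartiteBelow r p) := fun p _ => by
    refine (card_le_card fun q hq => ?_).trans (card_union_le _ _)
    obtain ⟨i, hpq | hqp⟩ := exists_forall_ne_le_or_forall_ne_le (x p) (x q)
    · exact mem_union_left _ (mem_filter.mpr ⟨hq, i, hpq⟩)
    · exact mem_union_right _ (mem_filter.mpr ⟨hq, i, hqp⟩)
  have pairs : #S * #S ≤ #S * (6 * m) :=
    calc #S * #S ≤ ∑ p ∈ S, (#(S.bipartiteAbove r p) + #(S.bipartiteBelow r p)) := by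
          simpa using card_nsmul_le_sum S _ _ total
      _ = 2 * ∑ p ∈ S, #(S.bipartiteAbove r p) := by
          rw [sum_add_distrib, ← sum_card_bipartiteAbove_eq_sum_card_bipartiteBelow, two_mul]
      _ ≤ 2 * (#S * (3 * m)) := by
          gcongr
          simpa using sum_le_card_nsmul S _ _ above
      _ = #S * (6 * m) := by ring
  rcases S.eq_empty_or_nonempty with rfl | hS
  · simp
  · exact Nat.le_of_mul_le_mul_left pairs hS.card_pos

open Classical in
theorem card_filter_not_isRich_le (k : ℕ) (x : X → Fin 3 → T) (S : Finset X) :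
    #{p ∈ S | ¬IsRich k x S p} ≤ 6 * k := by
  refine card_le_of_card_dominatorsOff_le x fun p hp i => ?_
  have hlt : #(dominatorsOff x S p i) < k :=
    lt_of_not_ge fun hk => (mem_filter.mp hp).2 ⟨i, hk⟩
  exact (card_le_card (dominatorsOff_mono x (filter_subset _ S) p i)).trans hlt.le

theorem exists_subset_card_eq_forall_notMem_le (g : X → T) (U : Finset X) {k : ℕ} (hk : k ≤ #U) :
    ∃ H ⊆ U, #H = k ∧ ∀ q ∈ H, ∀ u ∈ U, u ∉ H → g u ≤ g q := by
  classical
  induction k with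
  | zero => exact ⟨∅, by simp⟩
  | succ k ih =>
    obtain ⟨H, hHU, hcard, htop⟩ := ih (by omega)
    have hne : (U \ H).Nonempty := sdiff_nonempty.mpr fun hUH => by
      have := card_le_card hUH
      omega
    obtain ⟨m, hm, hmax⟩ := exists_max_image (U \ H) g hne
    obtain ⟨hmU, hmH⟩ := mem_sdiff.mp hm
    refine ⟨insert m H, insert_subset hmU hHU, by rw [card_insert_of_notMem hmH, hcard], ?_⟩
    intro q hq u hu huH
    obtain ⟨-, huH⟩ := not_or.mp (mem_insert.not.mp huH)
    rcases mem_insert.mp hq with heq | hq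
    · exact heq ▸ hmax u (mem_sdiff.mpr ⟨hu, huH⟩)
    · exact htop q hq u hu huH

variable [Fintype ι] [DecidableEq ι]

open Classical in
theorem exists_card_eq_forall_isUpperOrthant_subset (x : X → ι → T) (S : Finset X) (p : X)
    (i : ι) {k : ℕ} (hk : k ≤ #(dominatorsOff x S p i)) :
    ∃ H ⊆ S, #H = k ∧ ∀ R : Set X, IsUpperOrthant x R → p ∈ R →
      k ≤ #(dominatorsOff x {q ∈ S | q ∈ R} p i) → (H : Set X) ⊆ R := by
  obtain ⟨H, hHU, hcard, htop⟩ :=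
    exists_subset_card_eq_forall_notMem_le (fun q => x q i) (dominatorsOff x S p i) hk
  refine ⟨H, hHU.trans (filter_subset _ _), hcard, ?_⟩
  rintro R ⟨y, rfl⟩ hp hrich q hq
  by_contra hyq
  have hqi : x q i < y i := by
    by_contra! hi
    refine hyq fun j => ?_
    rcases eq_or_ne j i with rfl | hj
    · exact hi
    · exact (hp j).trans ((mem_dominatorsOff.mp (hHU hq)).2 j hj)
  have hsub : dominatorsOff x {q ∈ S | q ∈ x ⁻¹' Set.Ici y} p i ⊆ H := fun u hu => by
    by_contra huH
    have huU := dominatorsOff_mono x (filter_subset _ S) p i hu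
    have hyu : y ≤ x u := (mem_filter.mp (mem_dominatorsOff.mp hu).1).2
    exact (hyu i).not_gt ((htop q hq u huU huH).trans_lt hqi)
  have hq' := (eq_of_subset_of_card_le hsub (hcard.trans_le hrich)).symm ▸ hq
  exact hyq (mem_filter.mp (mem_dominatorsOff.mp hq').1).2

end Domination

section Incidences

open Finset

variable {X : Type*} {k : ℕ} {P : Finset X} {B : Finset (Set X)}

theorem IncidenceKFree.card_lt (h : IncidenceKFree k P B) {Y : Finset X} (hY : Y ⊆ P)
    {W : Finset (Set X)} (hW : W ⊆ B) (hYW : ∀ p ∈ Y, ∀ R ∈ W, p ∈ R) (hYk : k ≤ #Y) : #W < k := by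
  by_contra! hWk
  obtain ⟨u⟩ := Function.Embedding.nonempty_of_card_le (α := Fin k) (β := Y) (by simpa using hYk)
  obtain ⟨v⟩ := Function.Embedding.nonempty_of_card_le (α := Fin k) (β := W) (by simpa using hWk)
  let φ : Fin k ⊕ Fin k → P ⊕ B :=
    Sum.map (Set.inclusion hY ∘ u) (Set.inclusion hW ∘ v)
  have hφ : ∀ {s t}, (completeBipartiteGraph (Fin k) (Fin k)).Adj s t →
      (incidenceGraph P B).Adj (φ s) (φ t) := by
    rintro (i | i) (j | j) hij
    · simp at hij
    · exact hYW _ (u i).2 _ (v j).2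
    · exact hYW _ (u j).2 _ (v i).2
    · simp at hij
  exact h ⟨⟨φ, hφ⟩, ((Set.inclusion_injective hY).comp u.injective).sumMap
    ((Set.inclusion_injective hW).comp v.injective)⟩

theorem IncidenceKFree.anti_right {B' : Finset (Set X)} (hB : B' ⊆ B) (h : IncidenceKFree k P B) :
    IncidenceKFree k P B' := by
  let φ : P ⊕ B' → P ⊕ B := Sum.map id (Set.inclusion hB)
  have hφ : ∀ {s t}, (incidenceGraph P B').Adj s t → (incidenceGraph P B).Adj (φ s) (φ t) := by
    rintro (p | R) (q | S) hpq <;> exact hpq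
  exact fun hK => h (hK.trans ⟨⟨φ, hφ⟩, Function.injective_id.sumMap (Set.inclusion_injective hB)⟩)

open Classical in
theorem numIncidences_eq_sum (P : Finset X) (B : Finset (Set X)) :
    numIncidences P B = ∑ R ∈ B, #{p ∈ P | p ∈ R} := by
  have mem_iff : ∀ a : Σ _ : Set X, X,
      a ∈ B.sigma (fun R => {p ∈ P | p ∈ R}) ↔ a.1 ∈ B ∧ a.2 ∈ P ∧ a.2 ∈ a.1 := fun a => by
    rw [mem_sigma, mem_filter]
  rw [← card_sigma, ← Set.ncard_coe_finset, numIncidences]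
  refine (Set.ncard_congr (fun a ha => s(.inl ⟨a.2, ((mem_iff a).mp ha).2.1⟩,
    .inr ⟨a.1, ((mem_iff a).mp ha).1⟩)) (fun a ha => ((mem_iff a).mp ha).2.2) ?_ ?_).symm
  · rintro ⟨R, p⟩ ⟨S, q⟩ _ _ h
    simpa [and_comm] using h
  · rintro ⟨p | R, q | S⟩ hadj
    · exact hadj.elim
    · exact ⟨⟨S, p⟩, (mem_iff _).mpr ⟨S.2, p.2, hadj⟩, rfl⟩
    · exact ⟨⟨R, q⟩, (mem_iff _).mpr ⟨R.2, q.2, hadj⟩, Sym2.eq_swap⟩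
    · exact hadj.elim

variable {T ι : Type*} [LinearOrder T] [Fintype ι] [DecidableEq ι]

open Classical in
theorem card_filter_isRich_le (x : X → ι → T) (hB : ∀ R ∈ B, IsUpperOrthant x R)
    (h : IncidenceKFree k P B) (p : X) :
    #{R ∈ B | p ∈ R ∧ IsRich k x {q ∈ P | q ∈ R} p} ≤ Fintype.card ι * k := by
  let W (i : ι) : Finset (Set X) := {R ∈ B | p ∈ R ∧ k ≤ #(dominatorsOff x {q ∈ P | q ∈ R} p i)}
  have hW (i : ι) : #(W i) ≤ k := by
    by_cases hk : k ≤ #(dominatorsOff x P p i)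
    · obtain ⟨H, hHP, hcard, hH⟩ := exists_card_eq_forall_isUpperOrthant_subset x P p i hk
      refine (h.card_lt hHP (filter_subset _ B) (fun q hq R hR => ?_) hcard.ge).le
      obtain ⟨hRB, hpR, hrich⟩ := mem_filter.mp hR
      exact hH R (hB R hRB) hpR hrich hq
    · have hempty : W i = ∅ := filter_false_of_mem fun R _ hR => hk (hR.2.trans
        (card_le_card (dominatorsOff_mono x (filter_subset _ P) p i)))
      simp [hempty]
  calc #{R ∈ B | p ∈ R ∧ IsRich k x {q ∈ P | q ∈ R} p} ≤ #(univ.biUnion W) :=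
        card_le_card fun R hR => by
          obtain ⟨hRB, hpR, i, hi⟩ := mem_filter.mp hR
          exact mem_biUnion.mpr ⟨i, mem_univ i, mem_filter.mpr ⟨hRB, hpR, hi⟩⟩
    _ ≤ Fintype.card ι * k := card_biUnion_le_card_mul _ _ _ fun i _ => hW i

theorem numIncidences_le_of_isUpperOrthant (x : X → Fin 3 → T)
    (hB : ∀ R ∈ B, IsUpperOrthant x R) (h : IncidenceKFree k P B) :
    numIncidences P B ≤ 3 * k * #P + 6 * k * #B := by
  classical
  let S (R : Set X) : Finset X := {p ∈ P | p ∈ R}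
  have rich : ∑ R ∈ B, #{p ∈ S R | IsRich k x (S R) p} ≤ 3 * k * #P :=
    calc ∑ R ∈ B, #{p ∈ S R | IsRich k x (S R) p}
        = ∑ R ∈ B, #{p ∈ P | p ∈ R ∧ IsRich k x (S R) p} := by simp only [S, filter_filter]
      _ = ∑ p ∈ P, #{R ∈ B | p ∈ R ∧ IsRich k x (S R) p} :=
          (sum_card_bipartiteAbove_eq_sum_card_bipartiteBelow
            fun p R => p ∈ R ∧ IsRich k x (S R) p).symm
      _ ≤ #P * (3 * k) := by
          simpa using sum_le_card_nsmul P _ _ fun p _ => card_filter_isRich_le x hB h p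
      _ = 3 * k * #P := mul_comm _ _
  have poor : ∑ R ∈ B, #{p ∈ S R | ¬IsRich k x (S R) p} ≤ 6 * k * #B :=
    calc ∑ R ∈ B, #{p ∈ S R | ¬IsRich k x (S R) p} ≤ #B * (6 * k) := by
          simpa using sum_le_card_nsmul B _ _ fun R _ => card_filter_not_isRich_le k x (S R)
      _ = 6 * k * #B := mul_comm _ _
  calc numIncidences P B
      = ∑ R ∈ B, (#{p ∈ S R | IsRich k x (S R) p} + #{p ∈ S R | ¬IsRich k x (S R) p}) := by
        simp only [numIncidences_eq_sum, S, card_filter_add_card_filter_not]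
    _ ≤ 3 * k * #P + 6 * k * #B := by
        rw [sum_add_distrib]
        exact add_le_add rich poor

theorem numIncidences_le_of_exists_isUpperOrthant {κ : Type*} [Fintype κ] (x : κ → X → Fin 3 → T)
    (hB : ∀ R ∈ B, ∃ c, IsUpperOrthant (x c) R) (h : IncidenceKFree k P B) :
    numIncidences P B ≤ 3 * Fintype.card κ * k * #P + 6 * k * #B := by
  classical
  rcases B.eq_empty_or_nonempty with rfl | ⟨R₀, hR₀⟩
  · simp [numIncidences_eq_sum]
  have : Nonempty κ := ⟨(hB R₀ hR₀).choose⟩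
  choose! c hc using hB
  let F (i : κ) : Finset (Set X) := {R ∈ B | c R = i}
  have hF (i : κ) : numIncidences P (F i) ≤ 3 * k * #P + 6 * k * #(F i) := by
    refine numIncidences_le_of_isUpperOrthant (x i) (fun R hR => ?_)
      (h.anti_right (filter_subset _ B))
    obtain ⟨hRB, rfl⟩ := mem_filter.mp hR
    exact hc R hRB
  calc numIncidences P B = ∑ i, numIncidences P (F i) := by
        simp only [numIncidences_eq_sum, F]
        exact (sum_fiberwise B c _).symm
    _ ≤ ∑ i, (3 * k * #P + 6 * k * #(F i)) := sum_le_sum fun i _ => hF i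
    _ = 3 * Fintype.card κ * k * #P + 6 * k * #B := by
        have hBF : #B = ∑ i, #(F i) := card_eq_sum_card_fiberwise fun R _ => mem_univ (c R)
        rw [sum_add_distrib, sum_const, card_univ, smul_eq_mul, ← mul_sum, ← hBF]
        ring

end Incidences

theorem IsOrthant.exists_isUpperOrthant {R : Set (Fin 3 → ℝ)} (hR : IsOrthant R) :
    ∃ s : Fin 3 → Bool, IsUpperOrthant (fun p i => if s i then -p i else p i) R := by
  obtain ⟨q, s, rfl⟩ := hR
  refine ⟨s, fun i => if s i then -q i else q i, Set.ext fun p => forall_congr' fun i => ?_⟩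
  cases h : s i <;> simp [h]

theorem IsThreeSidedRectangle.exists_isUpperOrthant {R : Set (Fin 2 → ℝ)}
    (hR : IsThreeSidedRectangle R) :
    ∃ s : (Fin 2 × Fin 2) × Bool, IsUpperOrthant
      (fun p => ![p s.1.1, -p s.1.1, if s.2 then -p s.1.2 else p s.1.2]) R := by
  obtain ⟨i, j, a, b, h, -, -, rfl | rfl⟩ := hR
  · refine ⟨((i, j), true), ![a, -b, -h], Set.ext fun p => ?_⟩
    simp [Pi.le_def, Fin.forall_fin_succ, and_assoc]
  · refine ⟨((i, j), false), ![a, -b, h], Set.ext fun p => ?_⟩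
    simp [Pi.le_def, Fin.forall_fin_succ, and_assoc]

theorem mainTheorem9 :
    (∃ C : ℝ, 0 < C ∧
      ∀ (k n m : ℕ) (P : Finset (Fin 3 → ℝ)) (B : Finset (Set (Fin 3 → ℝ))),
        P.card = n → B.card = m → (∀ R ∈ B, IsOrthant R) → IncidenceKFree k P B →
          (numIncidences P B : ℝ) ≤ C * (k * (n + m))) ∧
    (∃ C : ℝ, 0 < C ∧
      ∀ (k n m : ℕ) (P : Finset (Fin 2 → ℝ)) (B : Finset (Set (Fin 2 → ℝ))),
        P.card = n → B.card = m → (∀ R ∈ B, IsThreeSidedRectangle R) → IncidenceKFree k P B →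
          (numIncidences P B : ℝ) ≤ C * (k * (n + m))) := by
  refine ⟨⟨24, by norm_num, ?_⟩, ⟨24, by norm_num, ?_⟩⟩
  · rintro k n m P B rfl rfl hB h
    have hI := numIncidences_le_of_exists_isUpperOrthant _
      (fun R hR => (hB R hR).exists_isUpperOrthant) h
    simp only [Fintype.card_fun, Fintype.card_bool, Fintype.card_fin] at hI
    exact_mod_cast (by nlinarith : numIncidences P B ≤ 24 * (k * (P.card + B.card)))
  · rintro k n m P B rfl rfl hB h
    have hI := numIncidences_le_of_exists_isUpperOrthant _
      (fun R hR => (hB R hR).exists_isUpperOrthant) h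
    simp only [Fintype.card_prod, Fintype.card_bool, Fintype.card_fin] at hI
    exact_mod_cast (by nlinarith : numIncidences P B ≤ 24 * (k * (P.card + B.card)))
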